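/- \textbf{Proposition (Finite convex program).} Let $\mathbb R^d\equiv\mathbb R^{d_1}\times\cdots\times\mathbb R^{d_n}$, let each factor $\mathbb R^{d_k}$ carry an arbitrary norm, denoted $\|\cdot\|$, with dual norm $\|z\|_*:=\sup_{\|x\|\le 1}\langle z,x\rangle$, and write ${\rm pr}_k(z)\in\mathbb R^{d_k}$ for the $k$-th block of $z\in\mathbb R^d$. Let $\Xi\subset\mathbb R^d$ be closed and convex, and let $h:\mathbb R^d\to\mathbb R$ be real-valued of the form $h(\xi)=\max_{j\in[m]}h_j(\xi)$, $m\ge1$, where each $-h_j:\mathbb R^d\to[-\infty,+\infty]$ is convex, proper, lower semicontinuous and not identically $+\infty$ on $\Xi$. Let $Q=\sum_{l=1}^M\vartheta_l\delta_{\xi^l}$ be a discrete probability distribution with atoms $\xi^1,\dots,\xi^M\in\Xi$ and masses $\vartheta_l\ge 0$, $\sum_l\vartheta_l=1$, and let $\boldsymbol\varepsilon=(\varepsilon_1,\dots,\varepsilon_n)$ with $\varepsilon_k>0$ for all $k\in[n]$. Let $\mathcal T_1(Q,\boldsymbol\varepsilon)$ be the multi-transport hyperrectangle of all second marginals of probability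 measures $\pi$ on $\Xi\times\Xi$ whose first marginal is $Q$ and which satisfy $\int\|\zeta_k-\xi_k\|\,{\rm d}\pi(\zeta,\xi)\le\varepsilon_k$ for all $k\in[n]$. Then the program \[ \begin{aligned} \inf_{\boldsymbol\lambda,\,s_l,\,z_{lj},\,\upsilon_{lj}}\;&\langle\boldsymbol\lambda,\boldsymbol\varepsilon\rangle+\sum_{l=1}^M\vartheta_l s_l\\ \text{s.t.}\quad&[-h_j]^*(z_{lj}-\upsilon_{lj})+\sigma_\Xi(\upsilon_{lj})-\langle z_{lj},\xi^l\rangle\le s_l,&& l\in[M],\ j\in[m],\\ &\|{\rm pr}_k(z_{lj})\|_*\le\lambda_k,&& l\in[M],\ j\in[m],\ k\in[n], \end{aligned} \] over $\boldsymbol\lambda\in\mathbb R^n$, $s_l\in\mathbb R$ and $z_{lj},\upsilon_{lj}\in\mathbb R^d$, is convex (its feasible set is convex and its objective is convex on it), and its value equals the worst-case expectation \[ \sup_{P\in\mathcal T_1(Q,\boldsymbol\varepsilon)}\mathbb E_P[h(\xi)]. \] Here $f^*(z):=\sup_{\xi\in\mathbb R^d}\{\langle z,\xi\rangle-f(\xi)\}$,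 $\sigma_\Xi(\upsilon):=\sup_{\xi\in\Xi}\langle\upsilon,\xi\rangle$, and $\mathbb E_P[h]:=\mathbb E_P[h^+]-\mathbb E_P[h^-]$ may take the value $-\infty$. -/

import Mathlib

open MeasureTheory
open scoped ENNReal Matrix

noncomputable section

namespace MTHProgram

/-- The space `ℝ^d ≡ ℝ^{d₁} × ⋯ × ℝ^{dₙ}` with its Borel σ-algebra; the projection onto the
`k`-th block of `z` is `z k`. -/
abbrev Vec {n : ℕ} (d : Fin n → ℕ) : Type := (k : Fin n) → Fin (d k) → ℝ

/-- The standard inner product on `ℝ^d ≡ ℝ^{d₁} × ⋯ × ℝ^{dₙ}`. -/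
def pair {n : ℕ} {d : Fin n → ℕ} (z ξ : Vec d) : ℝ := ∑ k, z k ⬝ᵥ ξ k

/-- The dual norm `‖z‖_* = sup_{‖x‖ ≤ 1} ⟨z, x⟩` of a norm on `ℝ^r`. -/
def dualNorm {r : ℕ} (N : Seminorm ℝ (Fin r → ℝ)) (z : Fin r → ℝ) : ℝ :=
  sSup {t : ℝ | ∃ x : Fin r → ℝ, N x ≤ 1 ∧ t = z ⬝ᵥ x}

/-- The conjugate `f^*(z) = sup_ξ {⟨z, ξ⟩ - f ξ}` of an extended-real-valued function. -/
def conj {n : ℕ} {d : Fin n → ℕ} (f : Vec d → EReal) (z : Vec d) : EReal :=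
  ⨆ ξ : Vec d, ((pair z ξ : ℝ) : EReal) - f ξ

/-- The support function `σ_Ξ(z) = sup_{ξ ∈ Ξ} ⟨z, ξ⟩`. -/
def supportFun {n : ℕ} {d : Fin n → ℕ} (Ξ : Set (Vec d)) (z : Vec d) : EReal :=
  ⨆ ξ ∈ Ξ, ((pair z ξ : ℝ) : EReal)

/-- Convexity of an extended-real-valued function: its epigraph is convex. -/
def IsConvexFun {n : ℕ} {d : Fin n → ℕ} (f : Vec d → EReal) : Prop :=
  Convex ℝ {q : Vec d × ℝ | f q.1 ≤ ((q.2 : ℝ) : EReal)}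

/-- A proper function: it never takes the value `-∞` and is not identically `+∞`. -/
def IsProperFun {n : ℕ} {d : Fin n → ℕ} (f : Vec d → EReal) : Prop :=
  (∀ ξ, f ξ ≠ ⊥) ∧ ∃ ξ, f ξ ≠ ⊤

/-- The discrete distribution `∑ ϑ_l δ_{ξ^l}`. -/
def discreteMeasure {α : Type*} [MeasurableSpace α] {M : ℕ} (ϑ : Fin M → ℝ) (a : Fin M → α) :
    Measure α :=
  ∑ l, ENNReal.ofReal (ϑ l) • Measure.dirac (a l)

/-- The multi-transport hyperrectangle `𝒯_p(Q, ε)` of distributions on `Ξ ⊆ X₁ × ⋯ × Xₙ`: second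
marginals of the probability measures `π` on `Ξ × Ξ` with first marginal `Q` and
`∫ ρ_k(ζ_k, ξ_k)^p dπ(ζ, ξ) ≤ ε_k^p` for all `k`. -/
def hyperrectangle {n : ℕ} {X : Fin n → Type*} [∀ k, MeasurableSpace (X k)]
    (Ξ : Set ((k : Fin n) → X k)) (ρ : (k : Fin n) → X k → X k → ℝ) (p : ℝ)
    (Q : Measure Ξ) (ε : Fin n → ℝ) : Set (Measure Ξ) :=
  {P | ∃ π : Measure (Ξ × Ξ), IsProbabilityMeasure π ∧ π.map Prod.fst = Q ∧
    (∀ k, ∫⁻ w, ENNReal.ofReal (ρ k (w.1.1 k) (w.2.1 k) ^ p) ∂π ≤ ENNReal.ofReal (ε k ^ p)) ∧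
    P = π.map Prod.snd}

/-- The expectation `E_P[f] = E_P[f⁺] - E_P[f⁻]` as an extended real number; it is `-∞` when
`f⁺` is integrable and `f⁻` is not. -/
def expectation {α : Type*} [MeasurableSpace α] (P : Measure α) (f : α → ℝ) : EReal :=
  ((∫⁻ x, ENNReal.ofReal (f x) ∂P : ℝ≥0∞) : EReal) -
    ((∫⁻ x, ENNReal.ofReal (-f x) ∂P : ℝ≥0∞) : EReal)

/-- The worst-case expectation `sup_{P ∈ A} E_P[f]`. -/
def worstCase {α : Type*} [MeasurableSpace α] (A : Set (Measure α)) (f : α → ℝ) : EReal :=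
  ⨆ P ∈ A, expectation P f

/-- The decision variables `(λ, s_l, z_lj, υ_lj)` of the finite program. -/
abbrev Var {n : ℕ} (d : Fin n → ℕ) (M m : ℕ) : Type :=
  (Fin n → ℝ) × (Fin M → ℝ) × (Fin M → Fin m → Vec d) × (Fin M → Fin m → Vec d)

/-- The feasible set: `[-h_j]^*(z_lj - υ_lj) + σ_Ξ(υ_lj) - ⟨z_lj, ξ^l⟩ ≤ s_l` and
`‖pr_k(z_lj)‖_* ≤ λ_k`. -/
def feasible {n : ℕ} {d : Fin n → ℕ} {M m : ℕ} (N : (k : Fin n) → Seminorm ℝ (Fin (d k) → ℝ))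
    (Ξ : Set (Vec d)) (hc : Fin m → Vec d → EReal) (a : Fin M → Vec d) : Set (Var d M m) :=
  {(lam, s, z, υ) |
    (∀ l j, conj (fun ξ => -hc j ξ) (z l j - υ l j) + supportFun Ξ (υ l j)
        - ((pair (z l j) (a l) : ℝ) : EReal) ≤ ((s l : ℝ) : EReal)) ∧
    ∀ l j k, dualNorm (N k) (z l j k) ≤ lam k}

/-- The objective `⟨λ, ε⟩ + ∑ ϑ_l s_l`. -/
def objective {n : ℕ} {d : Fin n → ℕ} {M m : ℕ} (ε : Fin n → ℝ) (ϑ : Fin M → ℝ)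
    (x : Var d M m) : ℝ :=
  ∑ k, x.1 k * ε k + ∑ l, ϑ l * x.2.1 l

end MTHProgram

end

/-! The value equality combines two dualities, neither of which requires attainment. Weak duality: a
feasible point gives `h ξ ≤ s l + ∑ k, lam k * N k (ξ k - a l k)` on `Ξ` (`le_add_of_mem_feasible`).
Integrating this against a coupling bounds the expectation by the objective
(`expectation_le_of_mem_hyperrectangle`). Strong duality: plans that split each atom into finitely
many pieces form the convex hull of the pure transport maps `Fin M → Ξ` in the space of budgets and
values. Separating `(ε, v)` from this hull yields multipliers `lam` (`exists_lagrange`). Since the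
Lagrangian is separable over the atoms, maximizing it atom by atom gives the numbers `s l`
(`exists_semiInfinite_dual`). It remains to turn a semi-infinite bound on one concave piece into
vectors `z` and `υ`. This is Fenchel duality for `-h_j`, the indicator of `Ξ` and the weighted norms
(`exists_multipliers`). An arbitrarily small slack `δ` replaces a constraint qualification; it
vanishes when infima are compared. Convexity holds because each constraint is a family of
inequalities affine in the variables, and the objective is linear. -/

namespace MTHProgram

/-! ### Linear functionals and norms in finite dimension. -/

section Preliminaries

section Pairing

variable {n : ℕ} {d : Fin n → ℕ}

lemma pair_add_left (z w ξ : Vec d) : pair (z + w) ξ = pair z ξ + pair w ξ := by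
  simp [pair, add_dotProduct, Finset.sum_add_distrib]

lemma pair_sub_left (z w ξ : Vec d) : pair (z - w) ξ = pair z ξ - pair w ξ := by
  simp [pair, sub_dotProduct, Finset.sum_sub_distrib]

lemma pair_smul_left (t : ℝ) (z ξ : Vec d) : pair (t • z) ξ = t * pair z ξ := by
  simp [pair, smul_dotProduct, Finset.mul_sum]

lemma pair_neg_left (z ξ : Vec d) : pair (-z) ξ = -pair z ξ := by
  simp [pair, neg_dotProduct]

lemma pair_zero_left (ξ : Vec d) : pair 0 ξ = 0 := by
  simp [pair]

lemma pair_comm (z ξ : Vec d) : pair z ξ = pair ξ z := by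
  simp [pair, dotProduct_comm]

lemma pair_add_right (z w ξ : Vec d) : pair ξ (z + w) = pair ξ z + pair ξ w := by
  simp [pair_comm ξ, pair_add_left]

lemma pair_sub_right (z w ξ : Vec d) : pair ξ (z - w) = pair ξ z - pair ξ w := by
  simp [pair_comm ξ, pair_sub_left]

lemma pair_smul_right (t : ℝ) (z ξ : Vec d) : pair ξ (t • z) = t * pair ξ z := by
  simp [pair_comm ξ, pair_smul_left]

lemma pair_neg_right (z ξ : Vec d) : pair ξ (-z) = -pair ξ z := by
  simp [pair_comm ξ, pair_neg_left]

lemma continuous_pair_left (ξ : Vec d) : Continuous fun z : Vec d => pair z ξ := by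
  unfold pair dotProduct
  fun_prop

/-- Every linear functional on `ℝ^r` is a dot product. -/
lemma exists_dotProduct_eq {r : ℕ} (f : (Fin r → ℝ) →ₗ[ℝ] ℝ) :
    ∃ z : Fin r → ℝ, ∀ x, f x = z ⬝ᵥ x := by
  refine ⟨fun i => f (Pi.single i 1), fun x => ?_⟩
  conv_lhs => rw [pi_eq_sum_univ' x]
  simp [dotProduct, mul_comm]

/-- Every linear functional on `Vec d` is of the form `z ↦ ⟨z, x⟩`. -/
lemma exists_pair_eq (f : Vec d →ₗ[ℝ] ℝ) : ∃ x : Vec d, ∀ z, f z = pair z x := by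
  choose x hx using fun k => exists_dotProduct_eq
    (f ∘ₗ LinearMap.single ℝ (fun k : Fin n => Fin (d k) → ℝ) k)
  refine ⟨x, fun z => ?_⟩
  conv_lhs => rw [← Finset.univ_sum_single z]
  simp only [map_sum, pair]
  refine Finset.sum_congr rfl fun k _ => ?_
  rw [dotProduct_comm]
  exact hx k (z k)

/-- Every continuous linear functional on `Vec d × ℝ` is `(z, r) ↦ ⟨z, x⟩ + τ r`. -/
lemma exists_pair_add_mul_eq (f : StrongDual ℝ (Vec d × ℝ)) :
    ∃ (x : Vec d) (τ : ℝ), ∀ z r, f (z, r) = pair z x + τ * r := by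
  obtain ⟨x, hx⟩ := exists_pair_eq ((f : Vec d × ℝ →ₗ[ℝ] ℝ) ∘ₗ LinearMap.inl ℝ _ _)
  refine ⟨x, f (0, 1), fun z r => ?_⟩
  have h1 : ((z, r) : Vec d × ℝ) = (z, 0) + r • (0, 1) := by simp
  have h2 : f (z, 0) = pair z x := hx z
  rw [h1, map_add, map_smul, h2, smul_eq_mul, mul_comm]

end Pairing

section Norms

variable {r : ℕ} (N : Seminorm ℝ (Fin r → ℝ))

lemma continuous_seminorm : Continuous N := by
  have h := N.convexOn
  exact continuousOn_univ.1 (h.continuousOn isOpen_univ)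

/-- A norm on `ℝ^r` dominates a multiple of the sup norm. -/
lemma exists_norm_le_mul (hN : ∀ x, N x = 0 → x = 0) :
    ∃ C : ℝ, 0 < C ∧ ∀ x, ‖x‖ ≤ C * N x := by
  -- The unit sphere is empty when `r = 0`; otherwise the minimum of `N` on it supplies the
  -- constant.
  rcases (Metric.sphere (0 : Fin r → ℝ) 1).eq_empty_or_nonempty with h0 | hne
  · refine ⟨1, one_pos, fun x => ?_⟩
    by_cases hx : x = 0
    · simp [hx]
    · exfalso
      have : ‖x‖⁻¹ • x ∈ Metric.sphere (0 : Fin r → ℝ) 1 := by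
        simp [norm_smul, norm_ne_zero_iff.2 hx]
      simp [h0] at this
  · obtain ⟨x₀, hx₀, hmin⟩ := (isCompact_sphere (0 : Fin r → ℝ) 1).exists_isMinOn hne
      (continuous_seminorm N).continuousOn
    have hpos : 0 < N x₀ := by
      refine lt_of_le_of_ne (apply_nonneg N x₀) fun h => ?_
      have h1 := hN x₀ h.symm
      simp [h1] at hx₀
    refine ⟨(N x₀)⁻¹, inv_pos.2 hpos, fun x => ?_⟩
    by_cases hx : x = 0
    · simp [hx]
    have hxn : 0 < ‖x‖ := norm_pos_iff.2 hx
    have h2 : N x₀ ≤ N (‖x‖⁻¹ • x) := hmin (by simp [norm_smul, hxn.ne'])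
    rw [map_smul_eq_mul, norm_inv, norm_norm] at h2
    rw [inv_mul_eq_div, le_div_iff₀ hpos]
    calc ‖x‖ * N x₀ ≤ ‖x‖ * (‖x‖⁻¹ * N x) := by gcongr
      _ = N x := by field_simp

lemma dotProduct_le_norm (z x : Fin r → ℝ) : z ⬝ᵥ x ≤ r * ‖z‖ * ‖x‖ := by
  calc z ⬝ᵥ x = ∑ i, z i * x i := rfl
    _ ≤ ∑ _i : Fin r, ‖z‖ * ‖x‖ := by
        refine Finset.sum_le_sum fun i _ => (le_abs_self _).trans ?_
        rw [abs_mul]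
        exact mul_le_mul (norm_le_pi_norm z i) (norm_le_pi_norm x i) (abs_nonneg _) (norm_nonneg _)
    _ = r * ‖z‖ * ‖x‖ := by simp [mul_assoc]

/-- Functionals of small sup norm have small dual norm. -/
lemma exists_forall_dotProduct_le (hN : ∀ x, N x = 0 → x = 0) {δ : ℝ} (hδ : 0 < δ) :
    ∃ ρ : ℝ, 0 < ρ ∧ ∀ z : Fin r → ℝ, ‖z‖ ≤ ρ → ∀ x, z ⬝ᵥ x ≤ δ * N x := by
  obtain ⟨C, hC, h⟩ := exists_norm_le_mul N hN
  refine ⟨δ / ((r + 1) * C), by positivity, fun z hz x => (dotProduct_le_norm z x).trans ?_⟩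
  calc r * ‖z‖ * ‖x‖ ≤ (r + 1) * (δ / ((r + 1) * C)) * (C * N x) := by
        gcongr
        · linarith
        · exact h x
    _ = δ * N x := by field_simp

lemma bddAbove_dualNorm (hN : ∀ x, N x = 0 → x = 0) (z : Fin r → ℝ) :
    BddAbove {t : ℝ | ∃ x : Fin r → ℝ, N x ≤ 1 ∧ t = z ⬝ᵥ x} := by
  obtain ⟨C, hC, h⟩ := exists_norm_le_mul N hN
  refine ⟨r * ‖z‖ * (C * 1), ?_⟩
  rintro _ ⟨x, hx, rfl⟩
  refine (dotProduct_le_norm z x).trans ?_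
  gcongr
  exact (h x).trans (by gcongr)

lemma dualNorm_nonneg (hN : ∀ x, N x = 0 → x = 0) (z : Fin r → ℝ) : 0 ≤ dualNorm N z :=
  le_csSup (bddAbove_dualNorm N hN z) ⟨0, by simp, by simp⟩

/-- The dual norm of `z` is at most `c` iff `⟨z, ·⟩ ≤ c N` (for `0 ≤ c`). -/
lemma dualNorm_le_iff (hN : ∀ x, N x = 0 → x = 0) (z : Fin r → ℝ) {c : ℝ} :
    dualNorm N z ≤ c ↔ 0 ≤ c ∧ ∀ x, z ⬝ᵥ x ≤ c * N x := by
  constructor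
  · intro h
    refine ⟨(dualNorm_nonneg N hN z).trans h, fun x => ?_⟩
    by_cases hx : N x = 0
    · simp [hN x hx]
    have hpos : 0 < N x := lt_of_le_of_ne (apply_nonneg N x) (Ne.symm hx)
    have h1 : z ⬝ᵥ ((N x)⁻¹ • x) ≤ c := by
      refine (le_csSup (bddAbove_dualNorm N hN z) ⟨_, ?_, rfl⟩).trans h
      rw [map_smul_eq_mul, norm_inv, Real.norm_of_nonneg hpos.le, inv_mul_cancel₀ hx]
    rw [dotProduct_smul, smul_eq_mul, inv_mul_eq_div, div_le_iff₀ hpos] at h1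
    exact h1
  · rintro ⟨hc, h⟩
    refine csSup_le ⟨0, 0, by simp, by simp⟩ ?_
    rintro _ ⟨x, hx, rfl⟩
    exact (h x).trans (mul_le_of_le_one_right hc hx)

/-- A norming functional for `y`. -/
lemma exists_dotProduct_eq_seminorm (y : Fin r → ℝ) :
    ∃ z : Fin r → ℝ, (∀ x, z ⬝ᵥ x ≤ N x) ∧ z ⬝ᵥ y = N y := by
  by_cases hy : y = 0
  · exact ⟨0, by simp, by simp [hy]⟩
  let f : (Fin r → ℝ) →ₗ.[ℝ] ℝ := LinearPMap.mkSpanSingleton y (N y) hy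
  obtain ⟨g, hg, hgN⟩ := exists_extension_of_le_sublinear f N
    (fun c hc x => by rw [map_smul_eq_mul, Real.norm_of_nonneg hc.le])
    (fun x y => map_add_le_add N x y)
    (by
      rintro ⟨x, hx⟩
      obtain ⟨t, rfl⟩ := Submodule.mem_span_singleton.1 hx
      rw [LinearPMap.mkSpanSingleton'_apply, map_smul_eq_mul, smul_eq_mul]
      gcongr
      exact le_abs_self t)
  obtain ⟨z, hz⟩ := exists_dotProduct_eq g
  refine ⟨z, fun x => hz x ▸ hgN x, ?_⟩
  rw [← hz]
  have h1 := hg ⟨y, Submodule.mem_span_singleton_self y⟩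
  rw [h1]
  exact LinearPMap.mkSpanSingleton_apply ℝ ℝ hy (N y)

end Norms

end Preliminaries

/-! ### Affine minorants, biconjugation and Fenchel multipliers. -/

section Minorants

variable {n : ℕ} {d : Fin n → ℕ}

/-- The affine function `ξ ↦ ⟨p, ξ⟩ - α` is a minorant of `f`. -/
def IsAffineMinorant (f : Vec d → EReal) (p : Vec d) (α : ℝ) : Prop :=
  ∀ ξ (r : ℝ), f ξ ≤ r → pair p ξ - α ≤ r

lemma isClosed_real_epigraph {f : Vec d → EReal} (hf : LowerSemicontinuous f) :
    IsClosed {q : Vec d × ℝ | f q.1 ≤ ((q.2 : ℝ) : EReal)} :=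
  hf.isClosed_epigraph.preimage
    (continuous_fst.prodMk (continuous_coe_real_ereal.comp continuous_snd))

/-- Separation of a point below the graph of `f` from the epigraph of `f`. -/
lemma exists_separation {f : Vec d → EReal} (hconv : IsConvexFun f) (hlsc : LowerSemicontinuous f)
    (hdom : ∃ ξ, ∃ r : ℝ, f ξ ≤ r) {w : Vec d} {c : ℝ} (hc : (c : EReal) < f w) :
    ∃ (q : Vec d) (τ u : ℝ), 0 ≤ τ ∧ pair q w + τ * c < u ∧
      ∀ ξ (r : ℝ), f ξ ≤ r → u < pair q ξ + τ * r := by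
  obtain ⟨φ, u, h1, h2⟩ := geometric_hahn_banach_point_closed (x := (w, c)) hconv
    (isClosed_real_epigraph hlsc) (by simpa using hc)
  obtain ⟨q, τ, hφ⟩ := exists_pair_add_mul_eq φ
  have h2' : ∀ ξ (r : ℝ), f ξ ≤ r → u < pair q ξ + τ * r := fun ξ r hr => by
    rw [pair_comm, ← hφ]
    exact h2 (ξ, r) hr
  rw [hφ, pair_comm] at h1
  refine ⟨q, τ, u, ?_, h1, h2'⟩
  obtain ⟨ξ, r, hr⟩ := hdom
  by_contra! hτ
  -- The epigraph is unbounded upwards: with `τ < 0`, raising `r` by this `t` would cross the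
  -- hyperplane.
  set t : ℝ := max 0 ((u - pair q ξ - τ * r) / τ)
  have h3 := h2' ξ (r + t) (hr.trans (by exact_mod_cast le_add_of_nonneg_right (le_max_left _ _)))
  have h4 : (u - pair q ξ - τ * r) / τ ≤ t := le_max_right _ _
  rw [div_le_iff_of_neg hτ] at h4
  linarith

/-- When `τ > 0` the separating hyperplane is not vertical, so dividing by `τ` makes it the graph of
an affine function. -/
lemma exists_affineMinorant_of_pos {f : Vec d → EReal} {q : Vec d} {τ u c : ℝ} {w : Vec d}
    (hτ : 0 < τ) (h1 : pair q w + τ * c < u)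
    (h2 : ∀ ξ (r : ℝ), f ξ ≤ r → u < pair q ξ + τ * r) :
    ∃ p α, IsAffineMinorant f p α ∧ c < pair p w - α := by
  refine ⟨-(τ⁻¹ • q), -(τ⁻¹ * u), fun ξ r hr => ?_, ?_⟩
  · have := h2 ξ r hr
    rw [pair_neg_left, pair_smul_left]
    have h3 : τ⁻¹ * u < τ⁻¹ * (pair q ξ + τ * r) := by gcongr
    rw [mul_add, inv_mul_cancel_left₀ hτ.ne'] at h3
    linarith
  · rw [pair_neg_left, pair_smul_left]
    have h3 : τ⁻¹ * (pair q w + τ * c) < τ⁻¹ * u := by gcongr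
    rw [mul_add, inv_mul_cancel_left₀ hτ.ne'] at h3
    linarith

/-- Separating a point just below the graph, over the domain of `f`, forces `τ > 0`, because the
graph point above it lies on the other side. -/
lemma exists_affineMinorant {f : Vec d → EReal} (hconv : IsConvexFun f)
    (hlsc : LowerSemicontinuous f) (hbot : ∀ ξ, f ξ ≠ ⊥) (hdom : ∃ ξ, ∃ r : ℝ, f ξ ≤ r) :
    ∃ p α, IsAffineMinorant f p α := by
  obtain ⟨ξ, r, hr⟩ := hdom
  obtain ⟨s, hs⟩ : ∃ s : ℝ, f ξ = s :=
    ⟨(f ξ).toReal, (EReal.coe_toReal (hr.trans_lt (EReal.coe_lt_top r)).ne (hbot ξ)).symm⟩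
  obtain ⟨q, τ, u, hτ, h1, h2⟩ := exists_separation hconv hlsc ⟨ξ, r, hr⟩ (w := ξ) (c := s - 1)
    (by rw [hs]; exact_mod_cast sub_one_lt s)
  have h3 := h2 ξ s hs.le
  obtain ⟨p, α, h, -⟩ := exists_affineMinorant_of_pos (by linarith) h1 h2
  exact ⟨p, α, h⟩

/-- A proper convex lower semicontinuous function is the supremum of its affine minorants. -/
lemma exists_affineMinorant_of_lt {f : Vec d → EReal} (hconv : IsConvexFun f)
    (hlsc : LowerSemicontinuous f) (hbot : ∀ ξ, f ξ ≠ ⊥) (hdom : ∃ ξ, ∃ r : ℝ, f ξ ≤ r)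
    {w : Vec d} {c : ℝ} (hc : (c : EReal) < f w) :
    ∃ p α, IsAffineMinorant f p α ∧ c < pair p w - α := by
  obtain ⟨q, τ, u, hτ, h1, h2⟩ := exists_separation hconv hlsc hdom hc
  rcases hτ.eq_or_lt with rfl | hτ
  · obtain ⟨p, α, hp⟩ := exists_affineMinorant hconv hlsc hbot hdom
    simp only [zero_mul, add_zero] at h1 h2
    have hpos : 0 < u - pair q w := by linarith
    -- A vertical hyperplane gives `u - pair q ξ`, negative on the domain of `f` and positive at
    -- `w`. Adding a large multiple of it to any affine minorant keeps a minorant and lifts its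
    -- value at `w` above `c`.
    set t : ℝ := max 0 ((c + 1 - (pair p w - α)) / (u - pair q w))
    have ht : 0 ≤ t := le_max_left _ _
    have ht' : (c + 1 - (pair p w - α)) / (u - pair q w) ≤ t := le_max_right _ _
    rw [div_le_iff₀ hpos] at ht'
    refine ⟨p - t • q, α - t * u, fun ξ r hr => ?_, ?_⟩
    · have h3 := hp ξ r hr
      have h4 := mul_nonneg ht (sub_nonneg.2 (h2 ξ r hr).le)
      rw [pair_sub_left, pair_smul_left]
      linarith
    · rw [pair_sub_left, pair_smul_left]
      linarith
  · exact exists_affineMinorant_of_pos hτ h1 h2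

/-- The biconjugate of the sum of `f` and the indicator of `Ξ`. -/
lemma mem_and_le_of_forall_minorant {f : Vec d → EReal} (hconv : IsConvexFun f)
    (hlsc : LowerSemicontinuous f) (hbot : ∀ ξ, f ξ ≠ ⊥) (hdom : ∃ ξ, ∃ r : ℝ, f ξ ≤ r)
    {Ξ : Set (Vec d)} (hΞ_closed : IsClosed Ξ) (hΞ_convex : Convex ℝ Ξ) {w : Vec d} {g : ℝ}
    (H : ∀ p υ α β, IsAffineMinorant f p α → (∀ η ∈ Ξ, pair υ η ≤ β) →
      pair (p + υ) w + g ≤ α + β) :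
    w ∈ Ξ ∧ f w ≤ ((-g : ℝ) : EReal) := by
  constructor
  · by_contra hw
    obtain ⟨φ, b, h1, h2⟩ := geometric_hahn_banach_closed_point hΞ_convex hΞ_closed hw
    obtain ⟨υ, hυ⟩ := exists_pair_eq (φ : Vec d →ₗ[ℝ] ℝ)
    have h1' : ∀ η ∈ Ξ, pair υ η ≤ b := fun η hη => by
      rw [pair_comm, ← hυ]
      exact (h1 η hη).le
    have h2' : b < pair υ w := by
      rw [pair_comm, ← hυ]
      exact h2
    obtain ⟨p, α, hp⟩ := exists_affineMinorant hconv hlsc hbot hdom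
    have hpos : 0 < pair υ w - b := by linarith
    -- The functional separating `w` from `Ξ` may be scaled freely; this scale violates `H`.
    set t : ℝ := max 0 ((1 + α - pair p w - g) / (pair υ w - b))
    have ht : 0 ≤ t := le_max_left _ _
    have ht' : (1 + α - pair p w - g) / (pair υ w - b) ≤ t := le_max_right _ _
    rw [div_le_iff₀ hpos] at ht'
    have h3 := H p (t • υ) α (t * b) hp fun η hη => by
      rw [pair_smul_left]
      exact mul_le_mul_of_nonneg_left (h1' η hη) ht
    rw [pair_add_left, pair_smul_left] at h3
    linarith
  · by_contra! hw
    obtain ⟨p, α, hp, h1⟩ := exists_affineMinorant_of_lt hconv hlsc hbot hdom hw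
    have h2 := H p 0 α 0 hp (by simp [pair_zero_left])
    rw [add_zero] at h2
    linarith

/-- `H` makes `w` a recession direction of `f` plus the indicator of `Ξ`, with slope at most `-u`.
The conclusion is the hypothesis of `mem_and_le_of_forall_minorant` along the ray from `ξ`. -/
lemma pair_add_smul_le {f : Vec d → EReal} {Ξ : Set (Vec d)} {ξ w : Vec d} {r u t : ℝ}
    (hξ : ξ ∈ Ξ) (hr : f ξ ≤ r) (ht : 0 ≤ t)
    (H : ∀ p υ α β, IsAffineMinorant f p α → (∀ η ∈ Ξ, pair υ η ≤ β) → pair (p + υ) w ≤ -u)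
    (p υ : Vec d) (α β : ℝ) (hp : IsAffineMinorant f p α) (hυ : ∀ η ∈ Ξ, pair υ η ≤ β) :
    pair (p + υ) (ξ + t • w) + (t * u - r) ≤ α + β := by
  have h1 := hp ξ r hr
  have h2 := hυ ξ hξ
  have h3 := mul_le_mul_of_nonneg_left (H p υ α β hp hυ) ht
  rw [pair_add_right, pair_smul_right, pair_add_left p υ ξ]
  linarith

/-- Dual multipliers: if `-f ≤ s + ∑ λ_k N_k(· - a)` on `Ξ`, then this bound is certified, up to any
`δ > 0`, by an affine minorant of `f` and an affine bound on `Ξ`. -/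
lemma exists_multipliers (N : (k : Fin n) → Seminorm ℝ (Fin (d k) → ℝ))
    (hN : ∀ k x, N k x = 0 → x = 0) {f : Vec d → EReal} (hconv : IsConvexFun f)
    (hlsc : LowerSemicontinuous f) (hbot : ∀ ξ, f ξ ≠ ⊥)
    {Ξ : Set (Vec d)} (hΞ_closed : IsClosed Ξ) (hΞ_convex : Convex ℝ Ξ)
    (hdom : ∃ ξ ∈ Ξ, ∃ r : ℝ, f ξ ≤ r) (a : Vec d) {lam : Fin n → ℝ} (hlam : ∀ k, 0 ≤ lam k)
    {s : ℝ} (hbd : ∀ ξ ∈ Ξ, ∀ r : ℝ, f ξ ≤ r → -r ≤ s + ∑ k, lam k * N k (ξ k - a k))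
    {δ : ℝ} (hδ : 0 < δ) :
    ∃ p υ α β, IsAffineMinorant f p α ∧ (∀ η ∈ Ξ, pair υ η ≤ β) ∧
      (∀ k x, (p + υ) k ⬝ᵥ x ≤ (lam k + δ) * N k x) ∧ α + β - pair (p + υ) a ≤ s + δ := by
  by_contra! hcon
  obtain ⟨ξ₀, hξ₀, r₀, hr₀⟩ := hdom
  have hdom' : ∃ ξ, ∃ r : ℝ, f ξ ≤ r := ⟨ξ₀, r₀, hr₀⟩
  choose ρ' hρ' hsmall' using fun k => exists_forall_dotProduct_le (N k) (hN k) hδ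
  obtain ⟨ρ, hρ, hsmall⟩ : ∃ ρ : ℝ, 0 < ρ ∧ ∀ k, ρ ≤ ρ' k := by
    rcases isEmpty_or_nonempty (Fin n) with h | h
    · exact ⟨1, one_pos, fun k => h.elim k⟩
    · exact ⟨Finset.univ.inf' Finset.univ_nonempty ρ', by simpa [Finset.lt_inf'_iff] using hρ',
        fun k => Finset.inf'_le _ (Finset.mem_univ k)⟩
  let K : Set (Vec d) := {z | ∀ k x, z k ⬝ᵥ x ≤ lam k * N k x}
  have hK : Convex ℝ K := by
    intro z hz w hw b c hb hc hbc k x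
    have h1 := mul_le_mul_of_nonneg_left (hz k x) hb
    have h2 := mul_le_mul_of_nonneg_left (hw k x) hc
    simp only [Pi.add_apply, Pi.smul_apply, add_dotProduct, smul_dotProduct, smul_eq_mul]
    calc _ ≤ (b + c) * (lam k * N k x) := by linarith
      _ = _ := by rw [hbc, one_mul]
  -- `G` collects the slopes and offsets available as certificates, `L` those that would suffice.
  -- Thickening `K` makes `L` open, and `ρ` is small enough for `δ` to absorb the enlargement in
  -- every norm.
  let L : Set (Vec d × ℝ) := {q | q.1 ∈ Metric.thickening ρ K ∧ q.2 < s + δ + pair q.1 a}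
  let G : Set (Vec d × ℝ) := {q | ∃ p υ α β, IsAffineMinorant f p α ∧ (∀ η ∈ Ξ, pair υ η ≤ β) ∧
    q = (p + υ, α + β)}
  have hLopen : IsOpen L :=
    (Metric.isOpen_thickening.preimage continuous_fst).inter
      (isOpen_lt continuous_snd (continuous_const.add ((continuous_pair_left a).comp continuous_fst)))
  have hLconv : Convex ℝ L := by
    rintro ⟨z, r⟩ ⟨hz, hr⟩ ⟨w, r'⟩ ⟨hw, hr'⟩ b c hb hc hbc
    refine ⟨hK.thickening ρ hz hw hb hc hbc, ?_⟩
    simp only [Prod.smul_mk, Prod.mk_add_mk, smul_eq_mul, pair_add_left, pair_smul_left] at hr hr' ⊢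
    have hc' : c = 1 - b := by linarith
    subst hc'
    rcases hb.eq_or_lt with rfl | hb
    · linarith
    · have h1 := mul_lt_mul_of_pos_left hr hb
      have h2 := mul_le_mul_of_nonneg_left hr'.le hc
      linarith
  have hGconv : Convex ℝ G := by
    rintro _ ⟨p, υ, α, β, hp, hυ, rfl⟩ _ ⟨p', υ', α', β', hp', hυ', rfl⟩ b c hb hc hbc
    refine ⟨b • p + c • p', b • υ + c • υ', b * α + c * α', b * β + c * β', ?_, ?_, ?_⟩
    · intro ξ r hr
      have h1 := mul_le_mul_of_nonneg_left (hp ξ r hr) hb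
      have h2 := mul_le_mul_of_nonneg_left (hp' ξ r hr) hc
      rw [pair_add_left, pair_smul_left, pair_smul_left]
      have h3 : b * r + c * r = r := by rw [← add_mul, hbc, one_mul]
      linarith
    · intro η hη
      have h1 := mul_le_mul_of_nonneg_left (hυ η hη) hb
      have h2 := mul_le_mul_of_nonneg_left (hυ' η hη) hc
      rw [pair_add_left, pair_smul_left, pair_smul_left]
      linarith
    · ext1
      · simp only [Prod.smul_mk, Prod.mk_add_mk]
        module
      · simp only [Prod.smul_mk, Prod.mk_add_mk, smul_eq_mul]
        ring
  have hdisj : Disjoint L G := by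
    rw [Set.disjoint_left]
    rintro _ ⟨hz, hr⟩ ⟨p, υ, α, β, hp, hυ, rfl⟩
    refine absurd (hcon p υ α β hp hυ fun k x => ?_) (by simp only at hr; linarith)
    obtain ⟨z, hzK, hdist⟩ := Metric.mem_thickening_iff.1 hz
    have h1 : ‖(p + υ) k - z k‖ ≤ ρ' k :=
      ((norm_le_pi_norm ((p + υ) - z) k).trans (dist_eq_norm (p + υ) z ▸ hdist.le)).trans (hsmall k)
    have h2 := hsmall' k _ h1 x
    have h3 := hzK k x
    rw [sub_dotProduct] at h2
    linarith
  obtain ⟨φ, u, hL, hG⟩ := geometric_hahn_banach_open hLconv hLopen hGconv hdisj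
  obtain ⟨x, τ, hφ⟩ := exists_pair_add_mul_eq φ
  have hG' : ∀ p υ α β, IsAffineMinorant f p α → (∀ η ∈ Ξ, pair υ η ≤ β) →
      u ≤ pair (p + υ) x + τ * (α + β) := fun p υ α β hp hυ => by
    rw [← hφ]
    exact hG _ ⟨p, υ, α, β, hp, hυ, rfl⟩
  have hL' : ∀ z ∈ K, ∀ r, r < s + δ + pair z a → pair z x + τ * r < u := fun z hz r hr => by
    rw [← hφ]
    exact hL _ ⟨Metric.self_subset_thickening hρ K hz, hr⟩
  obtain ⟨p₀, α₀, hp₀⟩ := exists_affineMinorant hconv hlsc hbot hdom'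
  have hτ : 0 ≤ τ := by
    by_contra! hτ
    set t : ℝ := max 0 ((u - 1 - pair p₀ x - τ * α₀) / τ)
    have ht : 0 ≤ t := le_max_left _ _
    have ht' : (u - 1 - pair p₀ x - τ * α₀) / τ ≤ t := le_max_right _ _
    rw [div_le_iff_of_neg hτ] at ht'
    have h1 := hG' p₀ 0 α₀ t hp₀ (fun η _ => by rwa [pair_zero_left])
    rw [add_zero] at h1
    linarith
  have hnorming : ∀ y : Vec d, ∃ z ∈ K, pair z y = ∑ k, lam k * N k (y k) := fun y => by
    choose z hz hzy using fun k => exists_dotProduct_eq_seminorm (N k) (y k)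
    refine ⟨fun k => lam k • z k, fun k x => ?_, ?_⟩
    · rw [smul_dotProduct, smul_eq_mul]
      exact mul_le_mul_of_nonneg_left (hz k x) (hlam k)
    · simp [pair, hzy]
  have hsub : ∀ y z : Vec d,
      ∑ k, lam k * N k (y k + z k) ≤ ∑ k, lam k * N k (y k) + ∑ k, lam k * N k (z k) := by
    intro y z
    rw [← Finset.sum_add_distrib]
    refine Finset.sum_le_sum fun k _ => ?_
    rw [← mul_add]
    exact mul_le_mul_of_nonneg_left (map_add_le_add _ _ _) (hlam k)
  rcases hτ.eq_or_lt with rfl | hτ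
  -- Degenerate separation: along `-x`, `-f` grows at rate at least `u`, while the bound `hbd` grows
  -- at rate at most `∑ k, lam k * N k (x k) < u`. A point far along the ray from `ξ₀` violates
  -- `hbd`.
  · simp only [zero_mul, add_zero] at hG' hL'
    obtain ⟨z, hzK, hz⟩ := hnorming x
    have h1 := hL' z hzK _ (sub_one_lt _)
    rw [hz] at h1
    have hpos : 0 < u - ∑ k, lam k * N k (x k) := by linarith
    have hneg : ∀ p υ α β, IsAffineMinorant f p α → (∀ η ∈ Ξ, pair υ η ≤ β) →
        pair (p + υ) (-x) ≤ -u := fun p υ α β hp hυ => by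
      rw [pair_neg_right]
      linarith [hG' p υ α β hp hυ]
    set A : ℝ := s + ∑ k, lam k * N k (ξ₀ k - a k)
    set t : ℝ := max 0 ((A + r₀ + 1) / (u - ∑ k, lam k * N k (x k)))
    have ht : 0 ≤ t := le_max_left _ _
    have ht' : (A + r₀ + 1) / (u - ∑ k, lam k * N k (x k)) ≤ t := le_max_right _ _
    rw [div_le_iff₀ hpos] at ht'
    obtain ⟨hmem, hle⟩ := mem_and_le_of_forall_minorant hconv hlsc hbot hdom' hΞ_closed hΞ_convex
      (pair_add_smul_le hξ₀ hr₀ ht hneg)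
    have h2 := hbd _ hmem _ hle
    have h3 := hsub (ξ₀ - a) (t • -x)
    have h4 : ∑ k, lam k * N k ((t • -x) k) = t * ∑ k, lam k * N k (x k) := by
      rw [Finset.mul_sum]
      refine Finset.sum_congr rfl fun k _ => ?_
      rw [Pi.smul_apply, Pi.neg_apply, map_smul_eq_mul, map_neg_eq_map, Real.norm_of_nonneg ht]
      ring
    have h5 : ∑ k, lam k * N k ((ξ₀ + t • -x) k - a k) =
        ∑ k, lam k * N k ((ξ₀ - a) k + (t • -x) k) := by
      refine Finset.sum_congr rfl fun k _ => ?_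
      rw [Pi.add_apply, Pi.sub_apply, add_sub_right_comm]
    rw [h4] at h3
    rw [h5] at h2
    simp only [Pi.sub_apply] at h3 h2
    linarith
  -- Nondegenerate separation: biconjugation places `w = -x/τ` in `Ξ` with `-f w ≥ u/τ`. A
  -- functional norming `a - w` then contradicts `hbd` by a margin of `δ / 2`.
  · obtain ⟨hmem, hle⟩ := mem_and_le_of_forall_minorant (w := -(τ⁻¹ • x)) (g := τ⁻¹ * u)
      hconv hlsc hbot hdom' hΞ_closed hΞ_convex fun p υ α β hp hυ => by
        have h1 := mul_le_mul_of_nonneg_left (hG' p υ α β hp hυ) (inv_pos.2 hτ).le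
        rw [mul_add, inv_mul_cancel_left₀ hτ.ne'] at h1
        rw [pair_neg_right, pair_smul_right]
        linarith
    have h1 := hbd _ hmem _ hle
    set w := -(τ⁻¹ • x) with hw
    obtain ⟨z, hzK, hz⟩ := hnorming (a - w)
    have h2 := hL' z hzK (s + δ / 2 + pair z a) (by linarith)
    have h3 := mul_le_mul_of_nonneg_left h2.le (inv_pos.2 hτ).le
    rw [mul_add, inv_mul_cancel_left₀ hτ.ne'] at h3
    have h4 : pair z w = -(τ⁻¹ * pair z x) := by rw [hw, pair_neg_right, pair_smul_right]
    have h5 : ∑ k, lam k * N k ((a - w) k) = ∑ k, lam k * N k (w k - a k) := by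
      refine Finset.sum_congr rfl fun k _ => ?_
      rw [Pi.sub_apply, map_sub_rev]
    rw [pair_sub_right, h5] at hz
    linarith

end Minorants

/-! ### The constraints as families of affine inequalities. -/

section Constraints

variable {n : ℕ} {d : Fin n → ℕ}

lemma conj_le_of_isAffineMinorant {f : Vec d → EReal} (hbot : ∀ ξ, f ξ ≠ ⊥) {p : Vec d} {α : ℝ}
    (h : IsAffineMinorant f p α) : conj f p ≤ (α : EReal) := by
  refine iSup_le fun ξ => ?_
  rcases eq_or_ne (f ξ) ⊤ with htop | htop
  · simp [htop]
  · have h1 := h ξ (f ξ).toReal (EReal.coe_toReal htop (hbot ξ)).ge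
    rw [← EReal.coe_toReal htop (hbot ξ), ← EReal.coe_sub, EReal.coe_le_coe_iff]
    linarith

lemma supportFun_le {Ξ : Set (Vec d)} {υ : Vec d} {β : ℝ} (h : ∀ η ∈ Ξ, pair υ η ≤ β) :
    supportFun Ξ υ ≤ (β : EReal) :=
  iSup₂_le fun η hη => EReal.coe_le_coe_iff.2 (h η hη)

/-- The constraint of the finite program as a family of affine inequalities. -/
lemma conj_add_supportFun_le_iff {f : Vec d → EReal} (hbot : ∀ ξ, f ξ ≠ ⊥)
    (hdom : ∃ ξ, ∃ r : ℝ, f ξ ≤ r) {Ξ : Set (Vec d)} (hΞ : Ξ.Nonempty) (q υ : Vec d) (c s : ℝ) :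
    conj f q + supportFun Ξ υ - (c : EReal) ≤ (s : EReal) ↔
      ∀ η ∈ Ξ, ∀ ξ, ∀ r : ℝ, f ξ ≤ r → pair q ξ + pair υ η - c - s ≤ r := by
  constructor
  · intro h η hη ξ r hr
    have h1 : ((pair q ξ - r : ℝ) : EReal) ≤ conj f q := by
      refine le_trans ?_ (le_iSup (fun ξ : Vec d => ((pair q ξ : ℝ) : EReal) - f ξ) ξ)
      rw [EReal.coe_sub]
      exact EReal.sub_le_sub le_rfl hr
    have h2 : ((pair υ η : ℝ) : EReal) ≤ supportFun Ξ υ :=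
      le_iSup₂ (f := fun (η : Vec d) (_ : η ∈ Ξ) => ((pair υ η : ℝ) : EReal)) η hη
    have h3 := (EReal.sub_le_sub (add_le_add h1 h2) (le_refl (c : EReal))).trans h
    rw [← EReal.coe_add, ← EReal.coe_sub, EReal.coe_le_coe_iff] at h3
    linarith
  · intro h
    obtain ⟨ξ₀, r₀, hr₀⟩ := hdom
    -- The inequality at `ξ₀` alone bounds `pair υ` on `Ξ`, so `β` is a genuine supremum, and `c + s
    -- - β` is what remains for the conjugate.
    set β : ℝ := sSup ((fun η => pair υ η) '' Ξ)
    have hbdd : BddAbove ((fun η => pair υ η) '' Ξ) := by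
      refine ⟨r₀ + c + s - pair q ξ₀, ?_⟩
      rintro _ ⟨η, hη, rfl⟩
      have := h η hη ξ₀ r₀ hr₀
      simp only
      linarith
    have h1 : conj f q ≤ ((c + s - β : ℝ) : EReal) := by
      refine conj_le_of_isAffineMinorant hbot fun ξ r hr => ?_
      have : β ≤ r + c + s - pair q ξ := by
        refine csSup_le (hΞ.image _) ?_
        rintro _ ⟨η, hη, rfl⟩
        have := h η hη ξ r hr
        simp only
        linarith
      linarith
    have h2 : supportFun Ξ υ ≤ (β : EReal) :=
      supportFun_le fun η hη => le_csSup hbdd ⟨η, hη, rfl⟩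
    refine (EReal.sub_le_sub (add_le_add h1 h2) (le_refl (c : EReal))).trans ?_
    rw [← EReal.coe_add, ← EReal.coe_sub, EReal.coe_le_coe_iff]
    linarith

variable {M m : ℕ} {N : (k : Fin n) → Seminorm ℝ (Fin (d k) → ℝ)} {Ξ : Set (Vec d)}
  {hc : Fin m → Vec d → EReal} {a : Fin M → Vec d}

/-- Feasibility as a family of linear inequalities. -/
lemma mem_feasible_iff (hN : ∀ k x, N k x = 0 → x = 0)
    (hc_proper : ∀ j, IsProperFun (fun ξ => -hc j ξ)) (hΞ : Ξ.Nonempty) (x : Var d M m) :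
    x ∈ feasible N Ξ hc a ↔
      (∀ l j, ∀ η ∈ Ξ, ∀ ξ, ∀ r : ℝ, -hc j ξ ≤ r → pair (x.2.2.1 l j - x.2.2.2 l j) ξ
        + pair (x.2.2.2 l j) η - pair (x.2.2.1 l j) (a l) - x.2.1 l ≤ r) ∧
      ∀ l j k, 0 ≤ x.1 k ∧ ∀ y, x.2.2.1 l j k ⬝ᵥ y ≤ x.1 k * N k y := by
  obtain ⟨lam, s, z, υ⟩ := x
  refine and_congr (forall₂_congr fun l j => ?_) (forall₃_congr fun l j k =>
    dualNorm_le_iff (N k) (hN k) _)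
  obtain ⟨hbot, ξ, hξ⟩ := hc_proper j
  exact conj_add_supportFun_le_iff hbot ⟨ξ, _, (EReal.coe_toReal hξ (hbot ξ)).ge⟩ hΞ _ _ _ _

lemma convex_feasible (hN : ∀ k x, N k x = 0 → x = 0)
    (hc_proper : ∀ j, IsProperFun (fun ξ => -hc j ξ)) (hΞ : Ξ.Nonempty) :
    Convex ℝ (feasible N Ξ hc a) := by
  intro x hx y hy b c hb hc hbc
  rw [mem_feasible_iff hN hc_proper hΞ] at hx hy ⊢
  constructor
  · intro l j η hη ξ r hr
    have h1 := mul_le_mul_of_nonneg_left (hx.1 l j η hη ξ r hr) hb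
    have h2 := mul_le_mul_of_nonneg_left (hy.1 l j η hη ξ r hr) hc
    have h3 : b * r + c * r = r := by rw [← add_mul, hbc, one_mul]
    simp only [Prod.fst_add, Prod.snd_add, Prod.smul_fst, Prod.smul_snd, Pi.add_apply,
      Pi.smul_apply, pair_add_left, pair_smul_left, pair_sub_left, smul_eq_mul] at h1 h2 ⊢
    linarith
  · intro l j k
    refine ⟨add_nonneg (mul_nonneg hb (hx.2 l j k).1) (mul_nonneg hc (hy.2 l j k).1), fun w => ?_⟩
    have h1 := mul_le_mul_of_nonneg_left ((hx.2 l j k).2 w) hb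
    have h2 := mul_le_mul_of_nonneg_left ((hy.2 l j k).2 w) hc
    simp only [Prod.fst_add, Prod.snd_add, Prod.smul_fst, Prod.smul_snd, Pi.add_apply,
      Pi.smul_apply, add_dotProduct, smul_dotProduct, smul_eq_mul]
    linarith

lemma objective_add_smul (ε : Fin n → ℝ) (ϑ : Fin M → ℝ) (x y : Var d M m) (b c : ℝ) :
    objective ε ϑ (b • x + c • y) = b * objective ε ϑ x + c * objective ε ϑ y := by
  simp only [objective, Prod.fst_add, Prod.snd_add, Prod.smul_fst, Prod.smul_snd, Pi.add_apply,
    Pi.smul_apply, smul_eq_mul, mul_add, Finset.mul_sum, add_mul, Finset.sum_add_distrib]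
  simp only [mul_assoc, mul_left_comm]
  ring

/-- A feasible point bounds each `h_j` on `Ξ` by `s_l + ∑ λ_k N_k(· - a_l)`. -/
lemma le_add_of_mem_feasible (hN : ∀ k x, N k x = 0 → x = 0)
    (hc_proper : ∀ j, IsProperFun (fun ξ => -hc j ξ)) {x : Var d M m}
    (hx : x ∈ feasible N Ξ hc a) {h : Vec d → ℝ} (h_max : ∀ ξ, ((h ξ : ℝ) : EReal) = ⨆ j, hc j ξ)
    (l : Fin M) {ξ : Vec d} (hξ : ξ ∈ Ξ) :
    h ξ ≤ x.2.1 l + ∑ k, x.1 k * N k (ξ k - a l k) := by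
  rw [mem_feasible_iff hN hc_proper ⟨ξ, hξ⟩] at hx
  rw [← EReal.coe_le_coe_iff, h_max]
  refine iSup_le fun j => ?_
  rcases eq_or_ne (hc j ξ) ⊥ with hbot | hbot
  · simp [hbot]
  have htop : hc j ξ ≠ ⊤ := by simpa using (hc_proper j).1 ξ
  lift hc j ξ to ℝ using ⟨htop, hbot⟩ with t ht
  -- Using the same point `ξ` in the conjugate and in the support function cancels `υ`.
  have h1 := hx.1 l j ξ hξ ξ (-t) (by rw [← ht, EReal.coe_neg])
  have h2 : pair (x.2.2.1 l j) (a l - ξ) ≤ ∑ k, x.1 k * N k (ξ k - a l k) := by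
    refine Finset.sum_le_sum fun k _ => ((hx.2 l j k).2 _).trans_eq ?_
    rw [Pi.sub_apply, map_sub_rev]
  rw [pair_sub_left] at h1
  rw [pair_sub_right] at h2
  rw [EReal.coe_le_coe_iff]
  linarith

end Constraints

/-! ### Expectations, discrete measures and weak duality. -/

section WeakDuality

section Expectation

variable {α : Type*} [MeasurableSpace α] {μ : Measure α} {f g : α → ℝ}

lemma expectation_map {β : Type*} [MeasurableSpace β] {φ : β → α} {ν : Measure β}
    (hφ : Measurable φ) (hf : Measurable f) :
    expectation (ν.map φ) f = expectation ν (f ∘ φ) := by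
  have h1 := lintegral_map (μ := ν) hf.neg.ennreal_ofReal hφ
  simp only [Pi.neg_apply] at h1
  rw [expectation, expectation, lintegral_map hf.ennreal_ofReal hφ, h1]
  rfl

lemma expectation_eq_integral (hf : Integrable f μ) :
    expectation μ f = ((∫ x, f x ∂μ : ℝ) : EReal) := by
  have h1 : ∫⁻ x, ENNReal.ofReal (f x) ∂μ ≠ ⊤ := hf.lintegral_lt_top.ne
  have h2 : ∫⁻ x, ENNReal.ofReal (-f x) ∂μ ≠ ⊤ := hf.neg.lintegral_lt_top.ne
  rw [integral_eq_lintegral_pos_part_sub_lintegral_neg_part hf, expectation, EReal.coe_sub,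
    EReal.coe_ennreal_toReal h1, EReal.coe_ennreal_toReal h2]

/-- If the negative part of `g` has infinite integral, the expectation is `⊥` by the `EReal`
convention for subtraction. Otherwise the bound by `f` makes `g` integrable. -/
lemma expectation_le_integral (hg : Measurable g) (hf : Integrable f μ) (h : g ≤ᵐ[μ] f) :
    expectation μ g ≤ ((∫ x, f x ∂μ : ℝ) : EReal) := by
  by_cases hneg : ∫⁻ x, ENNReal.ofReal (-g x) ∂μ = ⊤
  · simp [expectation, hneg]
  have hpos : ∫⁻ x, ENNReal.ofReal (g x) ∂μ ≠ ⊤ := by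
    refine ((lintegral_mono_ae ?_).trans_lt hf.lintegral_lt_top).ne
    filter_upwards [h] with x hx using ENNReal.ofReal_le_ofReal hx
  have hint : Integrable g μ := by
    refine ⟨hg.aestronglyMeasurable, ?_⟩
    rw [hasFiniteIntegral_iff_norm]
    calc ∫⁻ x, ENNReal.ofReal ‖g x‖ ∂μ
        ≤ ∫⁻ x, (ENNReal.ofReal (g x) + ENNReal.ofReal (-g x)) ∂μ := by
          refine lintegral_mono fun x => ?_
          rw [Real.norm_eq_abs]
          rcases le_total 0 (g x) with hx | hx
          · rw [abs_of_nonneg hx]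
            exact le_self_add
          · rw [abs_of_nonpos hx]
            exact le_add_self
      _ = ∫⁻ x, ENNReal.ofReal (g x) ∂μ + ∫⁻ x, ENNReal.ofReal (-g x) ∂μ :=
          lintegral_add_left hg.ennreal_ofReal _
      _ < ⊤ := ENNReal.add_lt_top.2 ⟨hpos.lt_top, Ne.lt_top hneg⟩
  rw [expectation_eq_integral hint, EReal.coe_le_coe_iff]
  exact integral_mono_ae hint hf h

end Expectation

section FiniteSupport

variable {α ι : Type*} [MeasurableSpace α] [Fintype ι]

lemma isProbabilityMeasure_sum_dirac {w : ι → ℝ} (hw : ∀ i, 0 ≤ w i) (hw_sum : ∑ i, w i = 1)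
    (x : ι → α) : IsProbabilityMeasure (∑ i, ENNReal.ofReal (w i) • Measure.dirac (x i)) := by
  constructor
  simp [← ENNReal.ofReal_sum_of_nonneg fun i _ => hw i, hw_sum]

lemma map_sum_dirac {β : Type*} [MeasurableSpace β] {φ : α → β} (hφ : Measurable φ) (w : ι → ℝ)
    (x : ι → α) : (∑ i, ENNReal.ofReal (w i) • Measure.dirac (x i)).map φ =
      ∑ i, ENNReal.ofReal (w i) • Measure.dirac (φ (x i)) := by
  rw [← Measure.mapₗ_apply_of_measurable hφ, map_sum]
  refine Finset.sum_congr rfl fun i _ => ?_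
  rw [Measure.mapₗ_apply_of_measurable hφ, Measure.map_smul, Measure.map_dirac' hφ]

variable [MeasurableSingletonClass α]

lemma integrable_sum_dirac (w : ι → ℝ) (x : ι → α) (f : α → ℝ) :
    Integrable f (∑ i, ENNReal.ofReal (w i) • Measure.dirac (x i)) :=
  integrable_finsetSum_measure.2 fun _ _ =>
    (integrable_dirac enorm_lt_top).smul_measure ENNReal.ofReal_ne_top

lemma integral_sum_dirac {w : ι → ℝ} (hw : ∀ i, 0 ≤ w i) (x : ι → α) (f : α → ℝ) :
    ∫ y, f y ∂(∑ i, ENNReal.ofReal (w i) • Measure.dirac (x i)) = ∑ i, w i * f (x i) := by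
  rw [integral_finsetSum_measure fun i _ =>
    (integrable_dirac enorm_lt_top).smul_measure ENNReal.ofReal_ne_top]
  refine Finset.sum_congr rfl fun i _ => ?_
  rw [integral_smul_measure, integral_dirac, ENNReal.toReal_ofReal (hw i), smul_eq_mul]

end FiniteSupport

variable {n : ℕ} {d : Fin n → ℕ} {M m : ℕ}

lemma measurable_of_coe_eq_iSup {h : Vec d → ℝ} {hc : Fin m → Vec d → EReal}
    (h_max : ∀ ξ, ((h ξ : ℝ) : EReal) = ⨆ j, hc j ξ)
    (hc_lsc : ∀ j, LowerSemicontinuous (fun ξ => -hc j ξ)) : Measurable h := by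
  have h1 : Measurable fun ξ => ⨆ j, hc j ξ := by
    refine Measurable.iSup fun j => ?_
    have h2 : hc j = fun ξ => -(-hc j ξ) := by simp
    rw [h2]
    exact (hc_lsc j).measurable.neg
  have h2 : h = fun ξ => (⨆ j, hc j ξ).toReal := by
    funext ξ
    rw [← h_max, EReal.toReal_coe]
  rw [h2]
  exact h1.ereal_toReal

/-- A function on the atoms of a discrete distribution that picks the smallest label. -/
lemma exists_measurable_min_label {α : Type*} [MeasurableSpace α] [MeasurableSingletonClass α]
    (a : Fin M → α) (s : Fin M → ℝ) :
    ∃ S : α → ℝ, Measurable S ∧ ∀ l, S (a l) ≤ s l ∧ ∃ i, a i = a l ∧ S (a l) = s i := by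
  classical
  have key : ∀ x : α, ∃ r : ℝ, (x ∉ Set.range a → r = 0) ∧
      ∀ l, a l = x → r ≤ s l ∧ ∃ i, a i = x ∧ r = s i := by
    intro x
    by_cases hx : x ∈ Set.range a
    · obtain ⟨l₀, hl₀⟩ := hx
      obtain ⟨i, hi, hmin⟩ := (Finset.univ.filter fun l => a l = x).exists_min_image s
        ⟨l₀, by simp [hl₀]⟩
      refine ⟨s i, fun h => absurd ⟨l₀, hl₀⟩ h, fun l hl => ⟨hmin l (by simp [hl]), i, ?_, rfl⟩⟩
      simpa using hi
    · exact ⟨0, fun _ => rfl, fun l hl => absurd ⟨l, hl⟩ hx⟩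
  choose S hS0 hS using key
  refine ⟨S, ?_, fun l => hS _ l rfl⟩
  refine measurable_of_measurable_on_compl_finite (Set.range a) (Set.finite_range a) ?_
  have : Set.domRestrict (Set.range a)ᶜ S = fun _ => 0 := funext fun x => hS0 _ x.2
  rw [this]
  exact measurable_const

/-- Weak duality. -/
lemma expectation_le_of_mem_hyperrectangle {N : (k : Fin n) → Seminorm ℝ (Fin (d k) → ℝ)}
    {Ξ : Set (Vec d)} {h : Vec d → ℝ} (hh : Measurable h) {ϑ : Fin M → ℝ} (hϑ : ∀ l, 0 ≤ ϑ l)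
    {a : Fin M → Ξ} {ε : Fin n → ℝ} (hε : ∀ k, 0 < ε k) {lam : Fin n → ℝ} (hlam : ∀ k, 0 ≤ lam k)
    {s : Fin M → ℝ}
    (H : ∀ l, ∀ ξ ∈ Ξ, h ξ ≤ s l + ∑ k, lam k * N k (ξ k - (a l : Vec d) k))
    {P : Measure Ξ}
    (hP : P ∈ hyperrectangle Ξ (fun k x y => N k (x - y)) 1 (discreteMeasure ϑ a) ε) :
    expectation P (fun ξ : Ξ => h ξ) ≤ ((∑ k, lam k * ε k + ∑ l, ϑ l * s l : ℝ) : EReal) := by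
  obtain ⟨π, hπ, hfst, hcost, rfl⟩ := hP
  -- Atoms may coincide, so `s l` need not be a function of the point `a l`. The smallest label at
  -- each point is one, and it still satisfies `H`.
  obtain ⟨S, hSm, hS⟩ := exists_measurable_min_label a s
  have hhm : Measurable fun ξ : Ξ => h ξ := hh.comp measurable_subtype_coe
  rw [expectation_map measurable_snd hhm]
  have hNm : ∀ k, Measurable fun w : Ξ × Ξ => N k ((w.1 : Vec d) k - (w.2 : Vec d) k) := fun k =>
    (continuous_seminorm (N k)).measurable.comp
      (((measurable_pi_apply k).comp (measurable_subtype_coe.comp measurable_fst)).sub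
        ((measurable_pi_apply k).comp (measurable_subtype_coe.comp measurable_snd)))
  have hcost' : ∀ k, ∫⁻ w, ENNReal.ofReal (N k ((w.1 : Vec d) k - (w.2 : Vec d) k)) ∂π ≤
      ENNReal.ofReal (ε k) := fun k => by simpa using hcost k
  have hNint : ∀ k, Integrable (fun w : Ξ × Ξ => N k ((w.1 : Vec d) k - (w.2 : Vec d) k)) π :=
    fun k => by
      refine ⟨(hNm k).aestronglyMeasurable, ?_⟩
      rw [hasFiniteIntegral_iff_ofReal (ae_of_all _ fun w => apply_nonneg _ _)]
      exact (hcost' k).trans_lt ENNReal.ofReal_lt_top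
  have hNle : ∀ k, ∫ w, N k ((w.1 : Vec d) k - (w.2 : Vec d) k) ∂π ≤ ε k := fun k => by
    rw [integral_eq_lintegral_of_nonneg_ae (ae_of_all _ fun w => apply_nonneg _ _)
      (hNm k).aestronglyMeasurable]
    exact ENNReal.toReal_le_of_le_ofReal (hε k).le (hcost' k)
  have hSQ : Integrable S (π.map Prod.fst) := by
    rw [hfst]
    exact integrable_sum_dirac ϑ a S
  have hSint : Integrable (fun w : Ξ × Ξ => S w.1) π := hSQ.comp_measurable measurable_fst
  have hSle : ∫ w, S w.1 ∂π ≤ ∑ l, ϑ l * s l := by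
    have h1 : ∫ w, S w.1 ∂π = ∫ x, S x ∂(π.map Prod.fst) :=
      (integral_map measurable_fst.aemeasurable hSm.aestronglyMeasurable).symm
    rw [h1, hfst, discreteMeasure, integral_sum_dirac hϑ]
    exact Finset.sum_le_sum fun l _ => mul_le_mul_of_nonneg_left (hS l).1 (hϑ l)
  have hsumint : Integrable
      (fun w : Ξ × Ξ => ∑ k, lam k * N k ((w.1 : Vec d) k - (w.2 : Vec d) k)) π :=
    integrable_finsetSum _ fun k _ => (hNint k).const_mul _
  have hatoms : ∀ᵐ w ∂π, w.1 ∈ Set.range a := by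
    have h1 : ∀ᵐ x ∂(π.map Prod.fst), x ∈ Set.range a := by
      rw [hfst, ae_iff, discreteMeasure, Measure.finsetSum_apply]
      refine Finset.sum_eq_zero fun l _ => ?_
      rw [Measure.smul_apply, Measure.dirac_apply]
      simp
    exact ae_of_ae_map measurable_fst.aemeasurable h1
  refine (expectation_le_integral (hhm.comp measurable_snd)
    (hSint.add hsumint) ?_).trans ?_
  · filter_upwards [hatoms] with w hw
    obtain ⟨l, hl⟩ := hw
    obtain ⟨-, i, hi, hSi⟩ := hS l
    have h1 := H i w.2 w.2.2
    rw [hi, hl] at h1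
    rw [hl] at hSi
    simp only [Pi.add_apply, hSi]
    simp only [map_sub_rev (N _)] at h1
    exact h1
  · rw [EReal.coe_le_coe_iff, integral_add' hSint hsumint,
      integral_finsetSum _ fun k _ => (hNint k).const_mul _, add_comm]
    refine add_le_add (Finset.sum_le_sum fun k _ => ?_) hSle
    rw [integral_const_mul]
    exact mul_le_mul_of_nonneg_left (hNle k) (hlam k)

end WeakDuality

/-! ### Lagrange multipliers and strong duality. -/

section StrongDuality

/-- Independent maximization of a separable weighted sum. -/
lemma sum_mul_iSup_le {α : Type*} [Nonempty α] {M : ℕ} {ϑ : Fin M → ℝ} (hϑ : ∀ l, 0 ≤ ϑ l)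
    (hϑ_sum : ∑ l, ϑ l = 1) {φ : Fin M → α → ℝ} {V : ℝ}
    (H : ∀ x : Fin M → α, ∑ l, ϑ l * φ l (x l) ≤ V) : ∑ l, ϑ l * ⨆ x, φ l x ≤ V := by
  refine le_of_forall_pos_le_add fun η hη => ?_
  choose x hx using fun l => exists_lt_of_lt_ciSup (sub_lt_self (⨆ x, φ l x) hη)
  calc ∑ l, ϑ l * ⨆ x, φ l x ≤ ∑ l, (ϑ l * φ l (x l) + ϑ l * η) := by
        refine Finset.sum_le_sum fun l _ => ?_
        rw [← mul_add]
        exact mul_le_mul_of_nonneg_left (by linarith [hx l]) (hϑ l)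
    _ ≤ V + η := by
        rw [Finset.sum_add_distrib, ← Finset.sum_mul, hϑ_sum, one_mul]
        linarith [H x]

variable {n : ℕ} {d : Fin n → ℕ} {M m : ℕ} {N : (k : Fin n) → Seminorm ℝ (Fin (d k) → ℝ)}
  {Ξ : Set (Vec d)} {h : Vec d → ℝ} {ϑ : Fin M → ℝ} {a : Fin M → Ξ} {ε : Fin n → ℝ}

/-- Splitting the atoms of the reference distribution gives a member of the hyperrectangle. -/
lemma sum_le_worstCase {ι : Type} [Fintype ι] (hϑ : ∀ l, 0 ≤ ϑ l) (hϑ_sum : ∑ l, ϑ l = 1)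
    {w : ι → ℝ} (hw : ∀ i, 0 ≤ w i) (hw_sum : ∑ i, w i = 1) (ξ : ι → Fin M → Ξ)
    (hcost : ∀ k, ∑ i, w i * ∑ l, ϑ l * N k ((a l : Vec d) k - (ξ i l : Vec d) k) ≤ ε k) :
    ((∑ i, w i * ∑ l, ϑ l * h (ξ i l) : ℝ) : EReal) ≤
      worstCase (hyperrectangle Ξ (fun k x y => N k (x - y)) 1 (discreteMeasure ϑ a) ε)
        (fun ξ : Ξ => h ξ) := by
  have hW : ∀ q : ι × Fin M, 0 ≤ w q.1 * ϑ q.2 := fun q => mul_nonneg (hw _) (hϑ _)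
  have hsum : ∀ F : ι → Fin M → ℝ,
      ∑ q : ι × Fin M, w q.1 * ϑ q.2 * F q.1 q.2 = ∑ i, w i * ∑ l, ϑ l * F i l := fun F => by
    simp only [Fintype.sum_prod_type, Finset.mul_sum, mul_assoc]
  have hW_sum : ∑ q : ι × Fin M, w q.1 * ϑ q.2 = 1 := by
    have h1 := hsum fun _ _ => 1
    simpa [hϑ_sum, hw_sum] using h1
  -- The share `w i` of the mass at `a l` moves to `ξ i l`; as the shares sum to one, the first
  -- marginal is unchanged.
  set π : Measure (Ξ × Ξ) :=
    ∑ q : ι × Fin M, ENNReal.ofReal (w q.1 * ϑ q.2) • Measure.dirac (a q.2, ξ q.1 q.2) with hπ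
  have hmem : π.map Prod.snd ∈
      hyperrectangle Ξ (fun k x y => N k (x - y)) 1 (discreteMeasure ϑ a) ε := by
    refine ⟨π, isProbabilityMeasure_sum_dirac hW hW_sum _, ?_, fun k => ?_, rfl⟩
    · rw [hπ, map_sum_dirac measurable_fst, Fintype.sum_prod_type_right, discreteMeasure]
      refine Finset.sum_congr rfl fun l _ => ?_
      dsimp only
      rw [← Finset.sum_smul, ← ENNReal.ofReal_sum_of_nonneg fun i _ => hW (i, l)]
      dsimp only
      rw [← Finset.sum_mul, hw_sum, one_mul]
    · simp only [Real.rpow_one]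
      rw [← ofReal_integral_eq_lintegral_ofReal (integrable_sum_dirac _ _ _)
        (ae_of_all _ fun q => apply_nonneg _ _), integral_sum_dirac hW]
      refine ENNReal.ofReal_le_ofReal ((hsum fun i l => _).trans_le (hcost k))
  refine le_trans ?_ (le_iSup₂ (f := fun P (_ : P ∈ hyperrectangle Ξ (fun k x y => N k (x - y)) 1
    (discreteMeasure ϑ a) ε) => expectation P fun ξ : Ξ => h ξ) _ hmem)
  rw [hπ, map_sum_dirac measurable_snd, expectation_eq_integral (integrable_sum_dirac _ _ _),
    integral_sum_dirac hW, EReal.coe_le_coe_iff]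
  exact (hsum fun i l => h (ξ i l)).ge

/-- Lagrange multipliers for the transport budgets. -/
lemma exists_lagrange (hϑ : ∀ l, 0 ≤ ϑ l) (hϑ_sum : ∑ l, ϑ l = 1) (hε : ∀ k, 0 < ε k) {v : ℝ}
    (hv : worstCase (hyperrectangle Ξ (fun k x y => N k (x - y)) 1 (discreteMeasure ϑ a) ε)
      (fun ξ : Ξ => h ξ) ≤ (v : EReal)) :
    ∃ lam : Fin n → ℝ, (∀ k, 0 ≤ lam k) ∧ ∀ ξ : Fin M → Ξ,
      ∑ l, ϑ l * h (ξ l) + ∑ k, lam k * ε k ≤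
        v + ∑ k, lam k * ∑ l, ϑ l * N k ((a l : Vec d) k - (ξ l : Vec d) k) := by
  let cost : (Fin M → Ξ) → Fin n → ℝ := fun ξ k =>
    ∑ l, ϑ l * N k ((a l : Vec d) k - (ξ l : Vec d) k)
  let A : Set ((Fin n → ℝ) × ℝ) :=
    {q | ∃ ξ : Fin M → Ξ, (∀ k, cost ξ k < q.1 k) ∧ q.2 < ∑ l, ϑ l * h (ξ l)}
  have hA : IsOpen A := by
    have h1 : A = ⋃ ξ : Fin M → Ξ,
        (⋂ k, {q : (Fin n → ℝ) × ℝ | cost ξ k < q.1 k}) ∩ {q | q.2 < ∑ l, ϑ l * h (ξ l)} := by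
      ext q
      simp [A]
    rw [h1]
    exact isOpen_iUnion fun ξ => (isOpen_iInter_of_finite fun k => isOpen_lt continuous_const
      (by fun_prop)).inter (isOpen_lt continuous_snd continuous_const)
  -- A convex combination reaching `(ε, v)` would be a splitting plan within budget whose value
  -- exceeds `v`.
  have hnot : (ε, v) ∉ convexHull ℝ A := by
    intro hmem
    obtain ⟨ι, _, w, z, hw, hw_sum, hz, hsum⟩ := mem_convexHull_iff_exists_fintype.1 hmem
    choose ξ hξ hr using hz
    have h1 : ∀ k, ∑ i, w i * (z i).1 k = ε k := fun k => by
      have := congrArg (fun q : (Fin n → ℝ) × ℝ => q.1 k) hsum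
      simpa [Prod.fst_sum] using this
    have h2 : ∑ i, w i * (z i).2 = v := by
      have := congrArg Prod.snd hsum
      simpa [Prod.snd_sum] using this
    have h3 := (sum_le_worstCase (N := N) (h := h) (a := a) (ε := ε) hϑ hϑ_sum hw hw_sum ξ fun k =>
      (Finset.sum_le_sum fun i _ => mul_le_mul_of_nonneg_left (hξ i k).le (hw i)).trans_eq
        (h1 k)).trans hv
    rw [EReal.coe_le_coe_iff, ← h2] at h3
    obtain ⟨i, hi⟩ : ∃ i, 0 < w i := by
      by_contra! hcon
      linarith [Finset.sum_nonpos fun i (_ : i ∈ Finset.univ) => hcon i]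
    refine h3.not_gt (Finset.sum_lt_sum
      (fun i _ => mul_le_mul_of_nonneg_left (hr i).le (hw i)) ⟨i, Finset.mem_univ i, ?_⟩)
    exact mul_lt_mul_of_pos_left (hr i) hi
  obtain ⟨f, hf⟩ := geometric_hahn_banach_open_point (convex_convexHull ℝ A) hA.convexHull hnot
  obtain ⟨g, hg⟩ := exists_dotProduct_eq ((f : (Fin n → ℝ) × ℝ →ₗ[ℝ] ℝ) ∘ₗ LinearMap.inl ℝ _ _)
  set μ : ℝ := f (0, 1)
  have hfeq : ∀ c r, f (c, r) = g ⬝ᵥ c + μ * r := fun c r => by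
    have h1 : ((c, r) : (Fin n → ℝ) × ℝ) = (c, 0) + r • (0, 1) := by simp
    have h2 : f (c, 0) = g ⬝ᵥ c := hg c
    rw [h1, map_add, map_smul, h2, smul_eq_mul, mul_comm]
  have hsep : ∀ (ξ : Fin M → Ξ) (c : Fin n → ℝ) (r : ℝ), (∀ k, cost ξ k < c k) →
      r < ∑ l, ϑ l * h (ξ l) → g ⬝ᵥ c + μ * r < g ⬝ᵥ ε + μ * v := fun ξ c r hc hr => by
    rw [← hfeq, ← hfeq]
    exact hf _ (subset_convexHull ℝ A ⟨ξ, hc, hr⟩)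
  have hcost0 : ∀ k, cost a k = 0 := fun k => by simp [cost]
  set r₀ : ℝ := min (∑ l, ϑ l * h (a l)) v - 1
  have hr₀ : r₀ < ∑ l, ϑ l * h (a l) := by linarith [min_le_left (∑ l, ϑ l * h (a l)) v]
  have hr₀v : r₀ < v := by linarith [min_le_right (∑ l, ϑ l * h (a l)) v]
  -- Slater's condition: leaving every atom in place costs nothing, strictly below each `ε k`.
  have hμ : 0 < μ := by
    have h1 := hsep a ε r₀ (fun k => by rw [hcost0]; exact hε k) hr₀
    have h2 : 0 < μ * (v - r₀) := by linarith
    exact pos_of_mul_pos_left h2 (by linarith)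
  have hg0 : ∀ k, g k ≤ 0 := fun k => by
    by_contra! hgk
    set t : ℝ := max 0 (μ * (v - r₀) / g k)
    have ht : 0 ≤ t := le_max_left _ _
    have ht' : μ * (v - r₀) / g k ≤ t := le_max_right _ _
    rw [div_le_iff₀ hgk] at ht'
    have h1 := hsep a (ε + Pi.single k t) r₀ (fun i => by
      rw [hcost0]
      have : 0 ≤ (Pi.single k t : Fin n → ℝ) i := by
        by_cases hi : i = k
        · subst hi
          simpa using ht
        · simp [hi]
      exact add_pos_of_pos_of_nonneg (hε i) this) hr₀
    rw [dotProduct_add, dotProduct_single] at h1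
    linarith
  refine ⟨fun k => -(μ⁻¹ * g k), fun k => neg_nonneg.2
    (mul_nonpos_of_nonneg_of_nonpos (inv_pos.2 hμ).le (hg0 k)), fun ξ => ?_⟩
  have hlam : ∀ c : Fin n → ℝ, ∑ k, -(μ⁻¹ * g k) * c k = -(μ⁻¹ * (g ⬝ᵥ c)) := fun c => by
    simp [dotProduct, Finset.mul_sum, mul_assoc]
  -- `A` is defined by strict inequalities; its boundary is reached by letting the slack `η`
  -- decrease to zero.
  have hlim : g ⬝ᵥ cost ξ + μ * ∑ l, ϑ l * h (ξ l) ≤ g ⬝ᵥ ε + μ * v := by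
    have hcont : Continuous fun η : ℝ =>
        g ⬝ᵥ (cost ξ + fun _ => η) + μ * (∑ l, ϑ l * h (ξ l) - η) := by
      unfold dotProduct
      simp only [Pi.add_apply]
      fun_prop
    have h1 := (hcont.tendsto 0).mono_left (nhdsWithin_le_nhds (s := Set.Ioi 0))
    have h2 : g ⬝ᵥ (cost ξ + fun _ => (0 : ℝ)) + μ * (∑ l, ϑ l * h (ξ l) - 0) ≤
        g ⬝ᵥ ε + μ * v := by
      refine le_of_tendsto h1 ?_
      filter_upwards [self_mem_nhdsWithin] with η hη
      have hη' : (0 : ℝ) < η := hη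
      exact (hsep ξ _ _ (fun k => lt_add_of_pos_right _ hη') (sub_lt_self _ hη')).le
    have h3 : (cost ξ + fun _ => (0 : ℝ)) = cost ξ := add_zero _
    rwa [h3, sub_zero] at h2
  have h4 := mul_le_mul_of_nonneg_left hlim (inv_pos.2 hμ).le
  rw [mul_add, mul_add, inv_mul_cancel_left₀ hμ.ne', inv_mul_cancel_left₀ hμ.ne'] at h4
  have h5 := hlam (cost ξ)
  rw [hlam ε]
  change _ ≤ v + ∑ k, -(μ⁻¹ * g k) * cost ξ k
  rw [h5]
  linarith

/-- Strong duality with the semi-infinite dual. -/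
lemma exists_semiInfinite_dual (hϑ : ∀ l, 0 ≤ ϑ l) (hϑ_sum : ∑ l, ϑ l = 1) (hε : ∀ k, 0 < ε k)
    {v : ℝ}
    (hv : worstCase (hyperrectangle Ξ (fun k x y => N k (x - y)) 1 (discreteMeasure ϑ a) ε)
      (fun ξ : Ξ => h ξ) ≤ (v : EReal)) :
    ∃ (lam : Fin n → ℝ) (s : Fin M → ℝ), (∀ k, 0 ≤ lam k) ∧
      (∀ l, ∀ ξ ∈ Ξ, h ξ ≤ s l + ∑ k, lam k * N k (ξ k - (a l : Vec d) k)) ∧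
      ∑ k, lam k * ε k + ∑ l, ϑ l * s l ≤ v := by
  obtain ⟨lam, hlam, H⟩ := exists_lagrange hϑ hϑ_sum hε hv
  let φ : Fin M → Ξ → ℝ := fun l ξ => h ξ - ∑ k, lam k * N k ((ξ : Vec d) k - (a l : Vec d) k)
  have hφ : ∀ ξ : Fin M → Ξ, ∑ l, ϑ l * φ l (ξ l) ≤ v - ∑ k, lam k * ε k := fun ξ => by
    have h1 : ∑ l, ϑ l * φ l (ξ l) = ∑ l, ϑ l * h (ξ l) -
        ∑ k, lam k * ∑ l, ϑ l * N k ((a l : Vec d) k - (ξ l : Vec d) k) := by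
      simp only [φ, mul_sub, Finset.sum_sub_distrib, Finset.mul_sum]
      rw [Finset.sum_comm]
      congr 1
      refine Finset.sum_congr rfl fun k _ => Finset.sum_congr rfl fun l _ => ?_
      rw [map_sub_rev]
      ring
    linarith [H ξ]
  obtain ⟨l₀, hl₀⟩ : ∃ l, 0 < ϑ l := by
    by_contra! hcon
    linarith [Finset.sum_nonpos fun i (_ : i ∈ Finset.univ) => hcon i]
  have hbdd₀ : ∃ C, ∀ ξ, φ l₀ ξ ≤ C := by
    refine ⟨(v - ∑ k, lam k * ε k - ∑ l ∈ Finset.univ.erase l₀, ϑ l * φ l (a l)) / ϑ l₀,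
      fun ξ => ?_⟩
    rw [le_div_iff₀ hl₀]
    -- Only the atom `l₀` moves, so its positive mass turns the bound on the sum into a bound on `φ
    -- l₀`.
    have h1 := hφ (Function.update a l₀ ξ)
    rw [← Finset.add_sum_erase _ _ (Finset.mem_univ l₀), Function.update_self,
      Finset.sum_congr rfl fun l hl => by rw [Function.update_of_ne (Finset.ne_of_mem_erase hl)]]
      at h1
    linarith
  obtain ⟨C, hC⟩ := hbdd₀
  -- Atoms of zero mass are invisible in `hφ`; the triangle inequality transfers the bound from
  -- `l₀`.
  have hbdd : ∀ l, BddAbove (Set.range (φ l)) := fun l => by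
    refine ⟨C + ∑ k, lam k * N k ((a l : Vec d) k - (a l₀ : Vec d) k), ?_⟩
    rintro _ ⟨ξ, rfl⟩
    have h1 := hC ξ
    have h2 : ∑ k, lam k * N k ((ξ : Vec d) k - (a l₀ : Vec d) k) ≤
        ∑ k, lam k * N k ((ξ : Vec d) k - (a l : Vec d) k) +
          ∑ k, lam k * N k ((a l : Vec d) k - (a l₀ : Vec d) k) := by
      rw [← Finset.sum_add_distrib]
      refine Finset.sum_le_sum fun k _ => ?_
      rw [← mul_add]
      refine mul_le_mul_of_nonneg_left ?_ (hlam k)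
      rw [← sub_add_sub_cancel ((ξ : Vec d) k) ((a l : Vec d) k) ((a l₀ : Vec d) k)]
      exact map_add_le_add _ _ _
    simp only [φ] at h1 ⊢
    linarith
  have : Nonempty Ξ := ⟨a l₀⟩
  refine ⟨lam, fun l => ⨆ ξ, φ l ξ, hlam, fun l ξ hξ => ?_, ?_⟩
  · have h1 : φ l ⟨ξ, hξ⟩ ≤ ⨆ ξ, φ l ξ := le_ciSup (hbdd l) _
    exact sub_le_iff_le_add.1 h1
  · linarith [sum_mul_iSup_le hϑ hϑ_sum hφ]

variable {hc : Fin m → Vec d → EReal}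

/-- Nearly optimal feasible points of the finite program from the semi-infinite dual. -/
lemma exists_mem_feasible (hN : ∀ k x, N k x = 0 → x = 0) (hΞ_closed : IsClosed Ξ)
    (hΞ_convex : Convex ℝ Ξ) (h_max : ∀ ξ, ((h ξ : ℝ) : EReal) = ⨆ j, hc j ξ)
    (hc_convex : ∀ j, IsConvexFun (fun ξ => -hc j ξ))
    (hc_proper : ∀ j, IsProperFun (fun ξ => -hc j ξ))
    (hc_lsc : ∀ j, LowerSemicontinuous (fun ξ => -hc j ξ))
    (hc_dom : ∀ j, ∃ ξ ∈ Ξ, -hc j ξ ≠ ⊤) {lam : Fin n → ℝ} {s : Fin M → ℝ}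
    (hlam : ∀ k, 0 ≤ lam k)
    (H : ∀ l, ∀ ξ ∈ Ξ, h ξ ≤ s l + ∑ k, lam k * N k (ξ k - (a l : Vec d) k))
    {δ : ℝ} (hδ : 0 < δ) :
    ∃ z υ : Fin M → Fin m → Vec d, ((fun k => lam k + δ, fun l => s l + δ, z, υ) : Var d M m) ∈
      feasible N Ξ hc (fun l => (a l : Vec d)) := by
  have key : ∀ l j, ∃ p υ α β, IsAffineMinorant (fun ξ => -hc j ξ) p α ∧
      (∀ η ∈ Ξ, pair υ η ≤ β) ∧ (∀ k x, (p + υ) k ⬝ᵥ x ≤ (lam k + δ) * N k x) ∧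
      α + β - pair (p + υ) (a l) ≤ s l + δ := fun l j => by
    obtain ⟨ξ, hξ, htop⟩ := hc_dom j
    refine exists_multipliers N hN (hc_convex j) (hc_lsc j) (hc_proper j).1 hΞ_closed hΞ_convex
      ⟨ξ, hξ, _, (EReal.coe_toReal htop ((hc_proper j).1 ξ)).ge⟩ _ hlam (fun ξ hξ r hr => ?_) hδ
    refine le_trans ?_ (H l ξ hξ)
    rw [← EReal.coe_le_coe_iff, h_max, EReal.coe_neg]
    exact (EReal.neg_le.1 hr).trans (le_iSup (fun j => hc j ξ) j)
  choose p υ α β hp hυ hz hs using key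
  -- With `z = p + υ`, the conjugate is evaluated at `z - υ = p`, the slope of the minorant.
  refine ⟨fun l j => p l j + υ l j, υ, fun l j => ?_, fun l j k => ?_⟩
  · simp only [add_sub_cancel_right]
    refine (EReal.sub_le_sub (add_le_add (conj_le_of_isAffineMinorant (hc_proper j).1 (hp l j))
      (supportFun_le (hυ l j))) le_rfl).trans ?_
    rw [← EReal.coe_add, ← EReal.coe_sub, EReal.coe_le_coe_iff]
    exact hs l j
  · rw [dualNorm_le_iff (N k) (hN k)]
    exact ⟨add_nonneg (hlam k) hδ.le, hz l j k⟩

end StrongDuality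

end MTHProgram

theorem mainTheorem4 {n : ℕ} (d : Fin n → ℕ) {M m : ℕ}
    -- a norm on each factor `ℝ^{d_k}`
    (N : (k : Fin n) → Seminorm ℝ (Fin (d k) → ℝ))
    (hN : ∀ k x, N k x = 0 → x = 0)
    -- the support
    (Ξ : Set (MTHProgram.Vec d)) (hΞ_closed : IsClosed Ξ) (hΞ_convex : Convex ℝ Ξ)
    -- the objective function as a maximum of concave functions
    (hm : 0 < m) (h : MTHProgram.Vec d → ℝ) (hc : Fin m → MTHProgram.Vec d → EReal)
    (h_max : ∀ ξ, ((h ξ : ℝ) : EReal) = ⨆ j, hc j ξ)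
    (hc_convex : ∀ j, MTHProgram.IsConvexFun (fun ξ => -hc j ξ))
    (hc_proper : ∀ j, MTHProgram.IsProperFun (fun ξ => -hc j ξ))
    (hc_lsc : ∀ j, LowerSemicontinuous (fun ξ => -hc j ξ))
    (hc_dom : ∀ j, ∃ ξ ∈ Ξ, -hc j ξ ≠ ⊤)
    -- the discrete reference distribution
    (ϑ : Fin M → ℝ) (hϑ : ∀ l, 0 ≤ ϑ l) (hϑ_sum : ∑ l, ϑ l = 1) (a : Fin M → Ξ)
    -- the transport budgets
    (ε : Fin n → ℝ) (hε : ∀ k, 0 < ε k) :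
    ConvexOn ℝ (MTHProgram.feasible N Ξ hc (fun l => (a l : MTHProgram.Vec d)))
      (MTHProgram.objective ε ϑ) ∧
    MTHProgram.worstCase
        (MTHProgram.hyperrectangle Ξ (fun k x y => N k (x - y)) 1
          (MTHProgram.discreteMeasure ϑ a) ε)
        (fun ξ : Ξ => h (ξ : MTHProgram.Vec d)) =
      ⨅ x ∈ MTHProgram.feasible N Ξ hc (fun l => (a l : MTHProgram.Vec d)),
        ((MTHProgram.objective ε ϑ x : ℝ) : EReal) := by
  open MTHProgram in
  obtain ⟨l₀⟩ : Nonempty (Fin M) := by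
    by_contra hM
    rw [not_nonempty_iff] at hM
    simp at hϑ_sum
  have hΞ : Ξ.Nonempty := ⟨a l₀, (a l₀).2⟩
  refine ⟨⟨convex_feasible hN hc_proper hΞ, fun x _ y _ b c _ _ _ =>
    (objective_add_smul ε ϑ x y b c).le⟩, le_antisymm ?_ ?_⟩
  · refine iSup₂_le fun P hP => le_iInf₂ fun x hx => ?_
    exact expectation_le_of_mem_hyperrectangle (measurable_of_coe_eq_iSup h_max hc_lsc) hϑ hε
      (fun k => (((mem_feasible_iff hN hc_proper hΞ x).1 hx).2 l₀ ⟨0, hm⟩ k).1)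
      (fun l ξ hξ => le_add_of_mem_feasible hN hc_proper hx h_max l hξ) hP
  · refine le_of_not_gt fun hlt => ?_
    obtain ⟨v, hv, hv'⟩ := EReal.lt_iff_exists_real_btwn.1 hlt
    obtain ⟨y, hy, hy'⟩ := EReal.lt_iff_exists_real_btwn.1 hv'
    rw [EReal.coe_lt_coe_iff] at hy
    obtain ⟨lam, s, hlam, H, hobj⟩ := exists_semiInfinite_dual hϑ hϑ_sum hε hv.le
    have hE : 0 < ∑ k, ε k + 1 := by
      linarith [Finset.sum_nonneg fun k (_ : k ∈ Finset.univ) => (hε k).le]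
    -- Raising every `lam k` and `s l` by `δ` raises the objective by `δ * (∑ k, ε k + 1)`, the `1`
    -- being the total mass. The choice of `δ` makes this increase exactly `y - v`.
    obtain ⟨z, υ, hx⟩ := exists_mem_feasible hN hΞ_closed hΞ_convex h_max hc_convex hc_proper hc_lsc
      hc_dom hlam H (div_pos (sub_pos.2 hy) hE)
    set δ : ℝ := (y - v) / (∑ k, ε k + 1) with hδ
    have h1 := hy'.trans_le (iInf₂_le _ hx)
    rw [EReal.coe_lt_coe_iff] at h1
    have h2 : objective ε ϑ ((fun k => lam k + δ, fun l => s l + δ, z, υ) : Var d M m) =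
        (∑ k, lam k * ε k + ∑ l, ϑ l * s l) + δ * (∑ k, ε k + 1) := by
      simp only [objective, add_mul, mul_add, Finset.sum_add_distrib, ← Finset.mul_sum,
        ← Finset.sum_mul, hϑ_sum]
      ring
    rw [h2, hδ, div_mul_cancel₀ _ hE.ne'] at h1
    linarith
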